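/- Let $\Omega\subseteq\mathbb R^3$ be a connected open set with Cartesian coordinates $(x_1,x_2,x_3)$. A linear strain-gradient elastic material is a triple of constant tensors $(\mathsf C,\mathsf M,\mathsf A)$ of orders $4,5,6$ with $\mathsf C_{ijlm}=\mathsf C_{jilm}=\mathsf C_{lmij}$, $\mathsf M_{ijklm}=\mathsf M_{jiklm}=\mathsf M_{ijlkm}$, $\mathsf A_{ijklmn}=\mathsf A_{jiklmn}=\mathsf A_{lmnijk}$. For a displacement field $u$ on $\Omega$ put $e_{lm}=\tfrac12(u_{l,m}+u_{m,l})$ and (summing over repeated indices) $$\sigma_{ik}=\mathsf C_{iklm}e_{lm}+\mathsf M_{iklmn}e_{lm,n},\qquad \tau_{ijk}=\mathsf M_{lmijk}e_{lm}+\mathsf A_{ijklmn}e_{lm,n}.$$ A displacement field is universal for a set of materials if $\sigma_{ik,i}-\tau_{ijk,ij}=0$ on $\Omega$ ($k=1,2,3$) for every material in the set. Let $R$ be the rotation through $\pi/2$ about the $x_3$-axis, $P$ the rotation through $\pi$ about the $x_1$-axis, and $-1$ the inversion, and consider the subgroups of $O(3)$ $$\mathbb Z_4^-=\langle -R\rangle,\quad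 \mathbb D_4^h=\langle -R,-P\rangle,\quad \mathbb D_4^v=\langle R,-P\rangle,\quad \mathbb Z_4=\langle R\rangle,\quad \mathbb D_4=\langle R,P\rangle,\quad \mathbb D_4\oplus\mathbb Z_2^c=\langle R,P,-1\rangle .$$ For $G$ one of the first five groups, the materials of class $G$ are those for which $\mathsf M$ and $\mathsf A$ are invariant under $G$ and $\mathsf C$ is invariant under $\mathbb D_4\oplus\mathbb Z_2^c$ (so that $\mathsf C$ has the six constants of the tetragonal class of classical linear elasticity). **Proposition.** Let $G$ be any one of $\mathbb Z_4^-,\mathbb D_4^h,\mathbb D_4^v,\mathbb Z_4,\mathbb D_4$, and let $u$ be a $C^4$ displacement field on $\Omega$. Then $u$ is universal for the materials of class $G$ if and only if it is the superposition of a homogeneous displacement field $x\mapsto a+Hx$ ($a\in\mathbb R^3$, $H\in\mathbb R^{3\times3}$) and a field $$\bigl(c_1x_2x_3+c_2x_1x_3,\; -c_2x_2x_3+c_3x_1x_3,\; g(x_1,x_2)\bigr),\qquad g(x_1,x_2)=d_1+d_2x_1+d_3x_2+d_4x_1x_2+d_5(x_2^2-x_1^2),$$ with real constants $c_1,c_2,c_3,d_1,\dots,d_5$.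 The same equivalence holds if $\mathsf C$ is only required to be invariant under $G$. -/

import Mathlib

namespace StrainGradient

noncomputable section

/-! Points of space and vectors are given by Cartesian coordinates; the coordinates
`x₁, x₂, x₃` are `x 0, x 1, x 2`. -/

/-- Coordinate space. -/
abbrev Space : Type := Fin 3 → ℝ

/-- The partial derivative `∂f/∂xᵢ`. -/
def partialD (i : Fin 3) (f : Space → ℝ) (x : Space) : ℝ :=
  fderiv ℝ f x (Pi.single i 1)

/-- The linearized strain `e_{lm} = (u_{l,m} + u_{m,l}) / 2`. -/
def strain (u : Space → Space) (l m : Fin 3) (x : Space) : ℝ :=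
  (partialD m (fun y => u y l) x + partialD l (fun y => u y m) x) / 2

/-- A homogeneous linear strain-gradient elastic material: constant elasticity tensors of orders
four, five and six with their index symmetries. -/
structure Material where
  C : Fin 3 → Fin 3 → Fin 3 → Fin 3 → ℝ
  M : Fin 3 → Fin 3 → Fin 3 → Fin 3 → Fin 3 → ℝ
  A : Fin 3 → Fin 3 → Fin 3 → Fin 3 → Fin 3 → Fin 3 → ℝ
  C_minor : ∀ i j l m, C i j l m = C j i l m
  C_major : ∀ i j l m, C i j l m = C l m i j
  M_left : ∀ i j k l m, M i j k l m = M j i k l m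
  M_right : ∀ i j k l m, M i j k l m = M i j l k m
  A_minor : ∀ i j k l m n, A i j k l m n = A j i k l m n
  A_major : ∀ i j k l m n, A i j k l m n = A l m n i j k

/-- The Cauchy stress `σ_{ik} = C_{iklm} e_{lm} + M_{iklmn} e_{lm,n}`. -/
def cauchyStress (mat : Material) (u : Space → Space) (i k : Fin 3) (x : Space) : ℝ :=
  ∑ l, ∑ m, mat.C i k l m * strain u l m x +
    ∑ l, ∑ m, ∑ n, mat.M i k l m n * partialD n (strain u l m) x

/-- The hyperstress `τ_{ijk} = M_{lmijk} e_{lm} + A_{ijklmn} e_{lm,n}`. -/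
def hyperStress (mat : Material) (u : Space → Space) (i j k : Fin 3) (x : Space) : ℝ :=
  ∑ l, ∑ m, mat.M l m i j k * strain u l m x +
    ∑ l, ∑ m, ∑ n, mat.A i j k l m n * partialD n (strain u l m) x

/-- Equilibrium without body forces on `Ω`: `σ_{ik,i} - τ_{ijk,ij} = 0`. -/
def InEquilibrium (mat : Material) (Ω : Set Space) (u : Space → Space) : Prop :=
  ∀ x ∈ Ω, ∀ k : Fin 3,
    ∑ i, partialD i (cauchyStress mat u i k) x -
      ∑ i, ∑ j, partialD i (partialD j (hyperStress mat u i j k)) x = 0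

/-- A displacement field is universal for a class `P` of materials if it is in equilibrium without
body forces for every material of the class. -/
def IsUniversal (P : Material → Prop) (Ω : Set Space) (u : Space → Space) : Prop :=
  ∀ mat : Material, P mat → InEquilibrium mat Ω u

/-- The orthogonal group `O(3)`. -/
abbrev O3 : Type := Matrix.orthogonalGroup (Fin 3) ℝ

/-- The orthogonal transformations that leave the fourth-order tensor invariant. -/
def symC (mat : Material) : Set O3 :=
  {Q | ∀ i j k l, ∑ o, ∑ p, ∑ q, ∑ r,
    Q.1 i o * Q.1 j p * Q.1 k q * Q.1 l r * mat.C o p q r = mat.C i j k l}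

/-- The orthogonal transformations that leave the fifth-order tensor invariant. -/
def symM (mat : Material) : Set O3 :=
  {Q | ∀ i j k l m, ∑ o, ∑ p, ∑ q, ∑ r, ∑ s,
    Q.1 i o * Q.1 j p * Q.1 k q * Q.1 l r * Q.1 m s * mat.M o p q r s = mat.M i j k l m}

/-- The orthogonal transformations that leave the sixth-order tensor invariant. -/
def symA (mat : Material) : Set O3 :=
  {Q | ∀ i j k l m n, ∑ o, ∑ p, ∑ q, ∑ r, ∑ s, ∑ t,
    Q.1 i o * Q.1 j p * Q.1 k q * Q.1 l r * Q.1 m s * Q.1 n t * mat.A o p q r s t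
      = mat.A i j k l m n}

/-- The material symmetries, `G_A ∩ G_M ∩ G_C`. -/
def symL (mat : Material) : Set O3 := symA mat ∩ symM mat ∩ symC mat

/-- The rotation through `π/2` about the `x₃`-axis. -/
def rotQuarter : O3 :=
  ⟨!![0, -1, 0; 1, 0, 0; 0, 0, 1], by
    rw [Matrix.mem_orthogonalGroup_iff]
    ext i j
    fin_cases i <;> fin_cases j <;>
      simp [Matrix.mul_apply, Fin.sum_univ_three]⟩

/-- The rotation through `π` about the `x₁`-axis. -/
def rotHalf : O3 :=
  ⟨!![1, 0, 0; 0, -1, 0; 0, 0, -1], by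
    rw [Matrix.mem_orthogonalGroup_iff]
    ext i j
    fin_cases i <;> fin_cases j <;>
      simp [Matrix.mul_apply, Fin.sum_univ_three]⟩

/-- The inversion `-1`. -/
def inversion : O3 :=
  ⟨!![-1, 0, 0; 0, -1, 0; 0, 0, -1], by
    rw [Matrix.mem_orthogonalGroup_iff]
    ext i j
    fin_cases i <;> fin_cases j <;>
      simp [Matrix.mul_apply, Fin.sum_univ_three]⟩

/-- The five symmetry classes `ℤ₄⁻`, `𝔻₄ʰ`, `𝔻₄ᵛ`, `ℤ₄`, `𝔻₄`. -/
inductive SymClass where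
  | Z4minus
  | D4h
  | D4v
  | Z4
  | D4

/-- The point group of each class, with four-fold (rotation or rotoinversion) axis `x₃`.
`inversion * rotHalf` is the reflection `x₁ ↦ -x₁`. -/
def SymClass.group : SymClass → Subgroup O3
  | .Z4minus => Subgroup.closure {inversion * rotQuarter}
  | .D4h => Subgroup.closure {inversion * rotQuarter, inversion * rotHalf}
  | .D4v => Subgroup.closure {rotQuarter, inversion * rotHalf}
  | .Z4 => Subgroup.closure {rotQuarter}
  | .D4 => Subgroup.closure {rotQuarter, rotHalf}

/-- The group `𝔻₄ ⊕ ℤ₂ᶜ`, which contains all five groups. A fourth-order elasticity tensor that it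
leaves invariant has the six constants of the tetragonal class of classical elasticity. -/
def groupD4Z2c : Subgroup O3 := Subgroup.closure {rotQuarter, rotHalf, inversion}

/-- All materials with the symmetries of the class. -/
def HasSymmetry (K : SymClass) (mat : Material) : Prop :=
  (K.group : Set O3) ⊆ symL mat

/-- All materials with the symmetries of the class whose fourth-order tensor has the six-constant
tetragonal form in the given axes. -/
def InClass (K : SymClass) (mat : Material) : Prop :=
  HasSymmetry K mat ∧ (groupD4Z2c : Set O3) ⊆ symC mat

/-- The homogeneous displacement field `x ↦ a + H x`. -/
def homogeneousField (a : Space) (H : Matrix (Fin 3) (Fin 3) ℝ) (x : Space) : Space :=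
  a + H.mulVec x

/-- The inhomogeneous displacement field of the classical tetragonal class. -/
def tetragonalField (c₁ c₂ c₃ : ℝ) (g : ℝ → ℝ → ℝ) (x : Space) : Space :=
  ![c₁ * x 1 * x 2 + c₂ * x 0 * x 2,
    -c₂ * x 1 * x 2 + c₃ * x 0 * x 2,
    g (x 0) (x 1)]

/-- The functions `d₁ + d₂ x₁ + d₃ x₂ + d₄ x₁ x₂ + d₅ (x₂² - x₁²)`. -/
def harmonicQuadratic (d : Fin 5 → ℝ) (s t : ℝ) : ℝ :=
  d 0 + d 1 * s + d 2 * t + d 3 * s * t + d 4 * (t ^ 2 - s ^ 2)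

/-- On `Ω`, `u` is a homogeneous field plus a tetragonal inhomogeneous field whose function `g` has
the restricted form. -/
def IsRestrictedTetragonal (Ω : Set Space) (u : Space → Space) : Prop :=
  ∃ (a : Space) (H : Matrix (Fin 3) (Fin 3) ℝ) (c₁ c₂ c₃ : ℝ) (d : Fin 5 → ℝ),
    ∀ x ∈ Ω, u x = homogeneousField a H x + tetragonalField c₁ c₂ c₃ (harmonicQuadratic d) x

end

end StrainGradient

/-! Subscripts 1, 2, 3 in the comments are the indices `0`, `1`, `2` of the code; `u_{k,ij}` are
second derivatives of displacement components.

Necessity uses few test materials. Setting `M = A = 0` and letting `C` run through the six basic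
tetragonal tensors yields the classical conditions on the Hessians
(`tetragonalHessian_of_isUniversal`). They force all third derivatives of `u_1` and `u_2` to vanish,
while `u_3` is, up to an affine function of `x₃`, a plane harmonic function of `x₁, x₂`. Its third
derivatives have only two free values, and one purely fifth-order material in each class
(`exists_inClass_couplingMaterial`) makes both vanish. On a connected set `u` is then a quadratic
polynomial, and the classical conditions on its constant Hessians leave exactly the stated family.

Sufficiency: for a quadratic field the strain gradient is constant, so `M` and `A` drop out of
equilibrium. Only `C_{iklm} e_{lm,i}` remains, and a four-fold axis alone makes it vanish: the
seventh constant `C₁₆` that it admits never meets a nonzero strain gradient.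

Fewer materials make universality weaker. Necessity is therefore proved for `InClass` and
sufficiency for the larger `HasSymmetry`, which gives both equivalences at once. -/

namespace StrainGradient

/-! ### Calculus of partial derivatives -/

section Calculus

variable {Ω : Set Space} {f g : Space → ℝ} {x : Space}

theorem partialD_congr (hΩ : IsOpen Ω) (h : Set.EqOn f g Ω) (i : Fin 3) (hx : x ∈ Ω) :
    partialD i f x = partialD i g x := by
  have : f =ᶠ[nhds x] g := Filter.eventually_of_mem (hΩ.mem_nhds hx) h
  rw [partialD, partialD, this.fderiv_eq]

theorem contDiffOn_partialD {m n : WithTop ℕ∞} (hΩ : IsOpen Ω) (hf : ContDiffOn ℝ n f Ω)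
    (hmn : m + 1 ≤ n) (i : Fin 3) : ContDiffOn ℝ m (partialD i f) Ω :=
  (hf.fderiv_of_isOpen hΩ hmn).clm_apply contDiffOn_const

theorem differentiableAt_of_contDiffOn {n : WithTop ℕ∞} (hΩ : IsOpen Ω)
    (hf : ContDiffOn ℝ n f Ω) (hn : n ≠ 0) (hx : x ∈ Ω) : DifferentiableAt ℝ f x :=
  (hf.differentiableOn hn).differentiableAt (hΩ.mem_nhds hx)

theorem partialD_add (i : Fin 3) (hf : DifferentiableAt ℝ f x) (hg : DifferentiableAt ℝ g x) :
    partialD i (fun y => f y + g y) x = partialD i f x + partialD i g x := by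
  simp [partialD, fderiv_fun_add hf hg]

theorem partialD_sub (i : Fin 3) (hf : DifferentiableAt ℝ f x) (hg : DifferentiableAt ℝ g x) :
    partialD i (fun y => f y - g y) x = partialD i f x - partialD i g x := by
  simp [partialD, fderiv_fun_sub hf hg]

theorem partialD_mul (i : Fin 3) (hf : DifferentiableAt ℝ f x) (hg : DifferentiableAt ℝ g x) :
    partialD i (fun y => f y * g y) x = f x * partialD i g x + partialD i f x * g x := by
  simp [partialD, fderiv_fun_mul hf hg, mul_comm]

theorem partialD_const_mul (i : Fin 3) (c : ℝ) (hf : DifferentiableAt ℝ f x) :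
    partialD i (fun y => c * f y) x = c * partialD i f x := by
  simp [partialD, fderiv_const_mul hf]

theorem partialD_sum {ι : Type*} [Fintype ι] {F : ι → Space → ℝ} (i : Fin 3)
    (hF : ∀ a, DifferentiableAt ℝ (F a) x) :
    partialD i (fun y => ∑ a, F a y) x = ∑ a, partialD i (F a) x := by
  simp [partialD, fderiv_fun_sum (u := Finset.univ) (fun a _ => hF a)]

theorem partialD_const (i : Fin 3) (c : ℝ) : partialD i (fun _ => c) x = 0 := by
  simp [partialD]

theorem partialD_coord (i j : Fin 3) :
    partialD i (fun y => y j) x = if j = i then 1 else 0 := by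
  have : fderiv ℝ (fun y : Space => y j) x = ContinuousLinearMap.proj j :=
    (ContinuousLinearMap.proj (R := ℝ) (φ := fun _ : Fin 3 => ℝ) j).fderiv
  simp [partialD, this, Pi.single_apply]

theorem partialD_comm (hΩ : IsOpen Ω) (hf : ContDiffOn ℝ 2 f Ω) (i j : Fin 3) (hx : x ∈ Ω) :
    partialD i (partialD j f) x = partialD j (partialD i f) x := by
  have hd : DifferentiableAt ℝ (fderiv ℝ f) x :=
    ((hf.fderiv_of_isOpen hΩ (m := 1) (by norm_num)).differentiableOn
      one_ne_zero).differentiableAt (hΩ.mem_nhds hx)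
  have key : ∀ v w : Space,
      fderiv ℝ (fun y => fderiv ℝ f y v) x w = fderiv ℝ (fderiv ℝ f) x w v := by
    intro v w
    rw [fderiv_clm_apply hd (differentiableAt_const v)]
    simp
  have hs : IsSymmSndFDerivAt ℝ f x :=
    (hf.contDiffAt (hΩ.mem_nhds hx)).isSymmSndFDerivAt (by simp)
  unfold partialD
  rw [key, key]
  exact hs _ _

theorem fderiv_eq_zero_of_partialD (h : ∀ i, partialD i f x = 0) : fderiv ℝ f x = 0 := by
  ext v
  rw [← Finset.univ_sum_single v, map_sum]
  refine Finset.sum_eq_zero fun i _ => ?_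
  have : Pi.single i (v i) = v i • (Pi.single i 1 : Space) := by
    rw [← Pi.single_smul]; simp
  rw [this, map_smul, show fderiv ℝ f x (Pi.single i 1) = 0 from h i, smul_zero]

theorem exists_const_of_partialD_eq_zero (hΩ : IsOpen Ω) (hc : IsPreconnected Ω)
    (hf : ContDiffOn ℝ 1 f Ω) (h : ∀ x ∈ Ω, ∀ i, partialD i f x = 0) :
    ∃ a, ∀ x ∈ Ω, f x = a :=
  hΩ.exists_is_const_of_fderiv_eq_zero hc (hf.differentiableOn one_ne_zero)
    fun x hx => fderiv_eq_zero_of_partialD (h x hx)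

/-- The quadratic polynomial with linear coefficients `b` and Hessian `h`. -/
noncomputable def quadraticFn (a : ℝ) (b : Fin 3 → ℝ) (h : Fin 3 → Fin 3 → ℝ) (x : Space) : ℝ :=
  a + ∑ j, b j * x j + ∑ i, ∑ j, h i j / 2 * (x i * x j)

theorem contDiff_quadraticFn (a : ℝ) (b : Fin 3 → ℝ) (h : Fin 3 → Fin 3 → ℝ)
    (n : WithTop ℕ∞) : ContDiff ℝ n (quadraticFn a b h) := by
  unfold quadraticFn
  fun_prop

theorem partialD_quadraticFn (a : ℝ) (b : Fin 3 → ℝ) {h : Fin 3 → Fin 3 → ℝ}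
    (hs : ∀ i j, h i j = h j i) (k : Fin 3) (x : Space) :
    partialD k (quadraticFn a b h) x = quadraticFn (b k) (h k) 0 x := by
  unfold quadraticFn
  rw [partialD_add k (by fun_prop) (by fun_prop), partialD_add k (by fun_prop) (by fun_prop),
    partialD_const, partialD_sum k (by fun_prop), partialD_sum k (by fun_prop)]
  have h1 : ∀ j, partialD k (fun y => b j * y j) x = b j * (if j = k then 1 else 0) := fun j => by
    rw [partialD_const_mul k _ (by fun_prop), partialD_coord]
  have h2 : ∀ i, partialD k (fun y => ∑ j, h i j / 2 * (y i * y j)) x =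
      ∑ j, h i j / 2 * (x i * (if j = k then 1 else 0) + (if i = k then 1 else 0) * x j) := by
    intro i
    rw [partialD_sum k (by fun_prop)]
    refine Finset.sum_congr rfl fun j _ => ?_
    rw [partialD_const_mul k _ (by fun_prop), partialD_mul k (by fun_prop) (by fun_prop),
      partialD_coord, partialD_coord]
  simp only [h1, h2, mul_add, Finset.sum_add_distrib, mul_ite, ite_mul, mul_one, mul_zero,
    zero_mul, one_mul, Finset.sum_ite_eq', Finset.mem_univ, if_true, Pi.zero_apply, zero_div,
    Finset.sum_const_zero]
  rw [Finset.sum_comm]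
  simp only [Finset.sum_ite_eq', Finset.mem_univ, if_true, hs _ k, ← Finset.sum_add_distrib,
    zero_add, add_zero]
  congr 1
  exact Finset.sum_congr rfl fun i _ => by ring

theorem partialD_partialD_quadraticFn (a : ℝ) (b : Fin 3 → ℝ) {h : Fin 3 → Fin 3 → ℝ}
    (hs : ∀ i j, h i j = h j i) (k l : Fin 3) (x : Space) :
    partialD k (partialD l (quadraticFn a b h)) x = h l k := by
  rw [show partialD l (quadraticFn a b h) = quadraticFn (b l) (h l) 0 from
    funext (partialD_quadraticFn a b hs l), partialD_quadraticFn _ _ (by simp)]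
  simp [quadraticFn]

/-- Integrate twice: the gradient of `f` differs from that of the pure quadratic form by a constant
vector `b`, and then `f` differs from the quadratic with linear part `b` by a constant.
Connectedness enters at both integrations. -/
theorem exists_eq_quadraticFn (hΩ : IsOpen Ω) (hc : IsPreconnected Ω) (hf : ContDiffOn ℝ 2 f Ω)
    {h : Fin 3 → Fin 3 → ℝ} (hs : ∀ i j, h i j = h j i)
    (hh : ∀ x ∈ Ω, ∀ i j, partialD i (partialD j f) x = h i j) :
    ∃ a b, ∀ x ∈ Ω, f x = quadraticFn a b h x := by
  have hq : ∀ a b, ContDiffOn ℝ 2 (quadraticFn a b h) Ω := fun a b =>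
    (contDiff_quadraticFn a b h 2).contDiffOn
  have d1 : ∀ j, ContDiffOn ℝ 1 (partialD j f) Ω := contDiffOn_partialD hΩ hf (by norm_num)
  have e1 : ∀ a b j, ContDiffOn ℝ 1 (partialD j (quadraticFn a b h)) Ω := fun a b =>
    contDiffOn_partialD hΩ (hq a b) (by norm_num)
  have hb : ∀ j, ∃ c, ∀ x ∈ Ω, partialD j f x - partialD j (quadraticFn 0 0 h) x = c := by
    intro j
    refine exists_const_of_partialD_eq_zero hΩ hc ((d1 j).sub (e1 0 0 j)) fun x hx i => ?_
    rw [partialD_sub i (differentiableAt_of_contDiffOn hΩ (d1 j) one_ne_zero hx)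
      (differentiableAt_of_contDiffOn hΩ (e1 0 0 j) one_ne_zero hx), hh x hx,
      partialD_partialD_quadraticFn _ _ hs, hs, sub_self]
  choose b hb using hb
  obtain ⟨a, ha⟩ : ∃ a, ∀ x ∈ Ω, f x - quadraticFn 0 b h x = a := by
    refine exists_const_of_partialD_eq_zero hΩ hc
      ((hf.sub (hq 0 b)).of_le (by norm_num)) fun x hx i => ?_
    rw [partialD_sub i (differentiableAt_of_contDiffOn hΩ hf two_ne_zero hx)
      (differentiableAt_of_contDiffOn hΩ (hq 0 b) two_ne_zero hx), partialD_quadraticFn _ _ hs]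
    have := hb i x hx
    rw [partialD_quadraticFn _ _ hs] at this
    simp only [quadraticFn, Pi.zero_apply] at this ⊢
    linarith
  refine ⟨a, b, fun x hx => ?_⟩
  have := ha x hx
  simp only [quadraticFn] at this ⊢
  linarith

end Calculus

/-! ### The equilibrium equations in terms of derivatives of the strain -/

section Equilibrium

variable {Ω : Set Space} {u : Space → Space} {x : Space}

theorem contDiffOn_component {n : WithTop ℕ∞} (hu : ContDiffOn ℝ n u Ω) (k : Fin 3) :
    ContDiffOn ℝ n (fun y => u y k) Ω :=
  contDiffOn_pi.1 hu k

theorem contDiffOn_strain (hΩ : IsOpen Ω) (hu : ContDiffOn ℝ 4 u Ω) (l m : Fin 3) :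
    ContDiffOn ℝ 3 (strain u l m) Ω :=
  ((contDiffOn_partialD hΩ (contDiffOn_component hu l) (by norm_num) m).add
    (contDiffOn_partialD hΩ (contDiffOn_component hu m) (by norm_num) l)).div_const 2

theorem partialD_strain (hΩ : IsOpen Ω) (hu : ContDiffOn ℝ 4 u Ω) (i l m : Fin 3) (hx : x ∈ Ω) :
    partialD i (strain u l m) x = (partialD i (partialD m fun y => u y l) x +
      partialD i (partialD l fun y => u y m) x) / 2 := by
  have hd : ∀ j k, DifferentiableAt ℝ (partialD j fun y => u y k) x := fun j k =>
    differentiableAt_of_contDiffOn (n := 3) hΩ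
      (contDiffOn_partialD hΩ (contDiffOn_component hu k) (by norm_num) j) (by norm_num) hx
  have : strain u l m = fun y => 2⁻¹ * ((partialD m fun y => u y l) y +
      (partialD l fun y => u y m) y) := by
    funext y
    simp only [strain]
    ring
  rw [this, partialD_const_mul i _ ((hd m l).fun_add (hd l m)), partialD_add i (hd m l) (hd l m)]
  ring

theorem partialD_partialD_strain (hΩ : IsOpen Ω) (hu : ContDiffOn ℝ 4 u Ω) (i j l m : Fin 3)
    (hx : x ∈ Ω) :
    partialD i (partialD j (strain u l m)) x = (partialD i (partialD j (partialD m fun y => u y l)) x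
      + partialD i (partialD j (partialD l fun y => u y m)) x) / 2 := by
  have hd : ∀ j n k, DifferentiableAt ℝ (partialD j (partialD n fun y => u y k)) x := fun j n k =>
    differentiableAt_of_contDiffOn (n := 2) hΩ (contDiffOn_partialD (n := 3) hΩ
      (contDiffOn_partialD hΩ (contDiffOn_component hu k) (by norm_num) n) (by norm_num) j)
        (by norm_num) hx
  have : Set.EqOn (partialD j (strain u l m)) (fun y => 2⁻¹ *
      (partialD j (partialD m fun y => u y l) y + partialD j (partialD l fun y => u y m) y)) Ω := by
    intro y hy
    simp only [partialD_strain hΩ hu j l m hy]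
    ring
  rw [partialD_congr hΩ this i hx, partialD_const_mul i _ ((hd j m l).fun_add (hd j l m)),
    partialD_add i (hd j m l) (hd j l m)]
  ring

theorem partialD_sum_add_sum {E : Fin 3 → Fin 3 → Space → ℝ}
    {F : Fin 3 → Fin 3 → Fin 3 → Space → ℝ} (c : Fin 3 → Fin 3 → ℝ)
    (d : Fin 3 → Fin 3 → Fin 3 → ℝ) (hE : ∀ l m, DifferentiableAt ℝ (E l m) x)
    (hF : ∀ l m n, DifferentiableAt ℝ (F l m n) x) (i : Fin 3) :
    partialD i (fun y => ∑ l, ∑ m, c l m * E l m y + ∑ l, ∑ m, ∑ n, d l m n * F l m n y) x =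
      ∑ l, ∑ m, c l m * partialD i (E l m) x +
        ∑ l, ∑ m, ∑ n, d l m n * partialD i (F l m n) x := by
  rw [partialD_add i (by fun_prop) (by fun_prop), partialD_sum i (by fun_prop),
    partialD_sum i (by fun_prop)]
  congr 1
  · refine Finset.sum_congr rfl fun l _ => ?_
    rw [partialD_sum i (by fun_prop)]
    exact Finset.sum_congr rfl fun m _ => partialD_const_mul i _ (hE l m)
  · refine Finset.sum_congr rfl fun l _ => ?_
    rw [partialD_sum i (by fun_prop)]
    refine Finset.sum_congr rfl fun m _ => ?_
    rw [partialD_sum i (by fun_prop)]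
    exact Finset.sum_congr rfl fun n _ => partialD_const_mul i _ (hF l m n)

theorem partialD_cauchyStress (hΩ : IsOpen Ω) (hu : ContDiffOn ℝ 4 u Ω) (mat : Material)
    (i k : Fin 3) (hx : x ∈ Ω) :
    partialD i (cauchyStress mat u i k) x =
      ∑ l, ∑ m, mat.C i k l m * partialD i (strain u l m) x +
        ∑ l, ∑ m, ∑ n, mat.M i k l m n * partialD i (partialD n (strain u l m)) x := by
  have hE : ∀ l m, DifferentiableAt ℝ (strain u l m) x := fun l m =>
    differentiableAt_of_contDiffOn hΩ (contDiffOn_strain hΩ hu l m) (by norm_num) hx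
  have hF : ∀ l m n, DifferentiableAt ℝ (partialD n (strain u l m)) x := fun l m n =>
    differentiableAt_of_contDiffOn (n := 2) hΩ (contDiffOn_partialD hΩ
      (contDiffOn_strain hΩ hu l m) (by norm_num) n) (by norm_num) hx
  exact partialD_sum_add_sum (mat.C i k) (mat.M i k) hE hF i

theorem partialD_partialD_hyperStress (hΩ : IsOpen Ω) (hu : ContDiffOn ℝ 4 u Ω) (mat : Material)
    (i j k : Fin 3) (hx : x ∈ Ω) :
    partialD i (partialD j (hyperStress mat u i j k)) x =
      ∑ l, ∑ m, mat.M l m i j k * partialD i (partialD j (strain u l m)) x +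
        ∑ l, ∑ m, ∑ n, mat.A i j k l m n *
          partialD i (partialD j (partialD n (strain u l m))) x := by
  have c2 : ∀ l m n, ContDiffOn ℝ 2 (partialD n (strain u l m)) Ω := fun l m =>
    contDiffOn_partialD hΩ (contDiffOn_strain hΩ hu l m) (by norm_num)
  have c1 : ∀ l m n, ContDiffOn ℝ 1 (partialD j (partialD n (strain u l m))) Ω := fun l m n =>
    contDiffOn_partialD hΩ (c2 l m n) (by norm_num) j
  have h1 : Set.EqOn (partialD j (hyperStress mat u i j k)) (fun y =>
      ∑ l, ∑ m, mat.M l m i j k * partialD j (strain u l m) y +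
        ∑ l, ∑ m, ∑ n, mat.A i j k l m n * partialD j (partialD n (strain u l m)) y) Ω :=
    fun y hy => partialD_sum_add_sum (fun l m => mat.M l m i j k) (mat.A i j k)
      (fun l m => differentiableAt_of_contDiffOn hΩ (contDiffOn_strain hΩ hu l m) (by norm_num) hy)
      (fun l m n => differentiableAt_of_contDiffOn hΩ (c2 l m n) (by norm_num) hy) j
  rw [partialD_congr hΩ h1 i hx]
  exact partialD_sum_add_sum (fun l m => mat.M l m i j k) (mat.A i j k)
      (fun l m => differentiableAt_of_contDiffOn hΩ (c2 l m j) (by norm_num) hx)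
      (fun l m n => differentiableAt_of_contDiffOn hΩ (c1 l m n) (by norm_num) hx) i

end Equilibrium


/-! ### Tensors invariant under a group generated by signed permutations -/

section Invariance

open Matrix
open scoped Kronecker

/-- The stabilizer of a vector in a representation is a subgroup. With `ρ` a Kronecker power of the
defining representation, this reduces tensor invariance to the generators of the group. -/
theorem mulVec_eq_of_mem_closure {ι : Type*} [Fintype ι] [DecidableEq ι]
    (ρ : O3 → Matrix ι ι ℝ) (h1 : ρ 1 = 1) (hmul : ∀ Q Q', ρ (Q * Q') = ρ Q * ρ Q')
    {S : Set O3} {v : ι → ℝ} (hS : ∀ Q ∈ S, ρ Q *ᵥ v = v) {Q : O3}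
    (hQ : Q ∈ Subgroup.closure S) : ρ Q *ᵥ v = v := by
  induction hQ using Subgroup.closure_induction with
  | mem Q hQ => exact hS Q hQ
  | one => rw [h1, one_mulVec]
  | mul Q Q' _ _ h h' => rw [hmul, ← mulVec_mulVec, h', h]
  | inv Q _ h =>
    conv_lhs => rw [← h]
    rw [mulVec_mulVec, ← hmul, inv_mul_cancel, h1, one_mulVec]

theorem closure_subset_symC {mat : Material} {S : Set O3} (h : S ⊆ symC mat) :
    (Subgroup.closure S : Set O3) ⊆ symC mat := by
  have key : ∀ Q : O3, Q ∈ symC mat ↔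
      (Q.1 ⊗ₖ (Q.1 ⊗ₖ (Q.1 ⊗ₖ Q.1))) *ᵥ (fun p => mat.C p.1 p.2.1 p.2.2.1 p.2.2.2) =
        fun p => mat.C p.1 p.2.1 p.2.2.1 p.2.2.2 := by
    intro Q
    simp [symC, funext_iff, mulVec, dotProduct, Fintype.sum_prod_type, mul_assoc]
  intro Q hQ
  refine (key Q).2 (mulVec_eq_of_mem_closure (fun Q : O3 => Q.1 ⊗ₖ (Q.1 ⊗ₖ (Q.1 ⊗ₖ Q.1)))
    (by simp) (fun Q Q' => by simp [mul_kronecker_mul]) (fun Q hQ => (key Q).1 (h hQ)) hQ)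

theorem closure_subset_symM {mat : Material} {S : Set O3} (h : S ⊆ symM mat) :
    (Subgroup.closure S : Set O3) ⊆ symM mat := by
  have key : ∀ Q : O3, Q ∈ symM mat ↔
      (Q.1 ⊗ₖ (Q.1 ⊗ₖ (Q.1 ⊗ₖ (Q.1 ⊗ₖ Q.1)))) *ᵥ
          (fun p => mat.M p.1 p.2.1 p.2.2.1 p.2.2.2.1 p.2.2.2.2) =
        fun p => mat.M p.1 p.2.1 p.2.2.1 p.2.2.2.1 p.2.2.2.2 := by
    intro Q
    simp [symM, funext_iff, mulVec, dotProduct, Fintype.sum_prod_type, mul_assoc]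
  intro Q hQ
  refine (key Q).2 (mulVec_eq_of_mem_closure
    (fun Q : O3 => Q.1 ⊗ₖ (Q.1 ⊗ₖ (Q.1 ⊗ₖ (Q.1 ⊗ₖ Q.1))))
    (by simp) (fun Q Q' => by simp [mul_kronecker_mul]) (fun Q hQ => (key Q).1 (h hQ)) hQ)

/-- `Q` is the signed permutation matrix with entries `s i` at `(i, σ i)`. -/
def IsSignedPerm (Q : O3) (σ : Fin 3 → Fin 3) (s : Fin 3 → ℤ) : Prop :=
  ∀ i o, Q.1 i o = if o = σ i then (s i : ℝ) else 0

theorem isSignedPerm_rotQuarter : IsSignedPerm rotQuarter ![1, 0, 2] ![-1, 1, 1] := by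
  intro i o
  fin_cases i <;> fin_cases o <;> simp [rotQuarter]

theorem isSignedPerm_rotHalf : IsSignedPerm rotHalf ![0, 1, 2] ![1, -1, -1] := by
  intro i o
  fin_cases i <;> fin_cases o <;> simp [rotHalf]

theorem isSignedPerm_inversion : IsSignedPerm inversion ![0, 1, 2] ![-1, -1, -1] := by
  intro i o
  fin_cases i <;> fin_cases o <;> simp [inversion]

theorem IsSignedPerm.inversion_mul {Q : O3} {σ : Fin 3 → Fin 3} {s : Fin 3 → ℤ}
    (h : IsSignedPerm Q σ s) : IsSignedPerm (inversion * Q) σ (fun i => -s i) := by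
  intro i o
  have hi : (inversion * Q).1 i o = -Q.1 i o := by
    have : inversion.1 = -1 := by
      ext i j
      fin_cases i <;> fin_cases j <;> simp [inversion]
    change (inversion.1 * Q.1) i o = _
    rw [this, neg_one_mul, Matrix.neg_apply]
  rw [hi, h i o]
  split_ifs <;> simp

/-- Each row of `Q` has at most one nonzero entry, so the fourfold sum collapses to one term. For
tensors with integer entries the resulting identities are finitely many and decidable. -/
theorem IsSignedPerm.mem_symC {Q : O3} {σ : Fin 3 → Fin 3} {s : Fin 3 → ℤ}
    (h : IsSignedPerm Q σ s) {mat : Material} :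
    Q ∈ symC mat ↔ ∀ i j k l,
      s i * s j * s k * s l * mat.C (σ i) (σ j) (σ k) (σ l) = mat.C i j k l := by
  have e : ∀ (i : Fin 3) (F : Fin 3 → ℝ), ∑ o, Q.1 i o * F o = s i * F (σ i) := by
    intro i F
    simp [h i]
  simp only [symC, Set.mem_ofPred_eq, mul_assoc, e, ← Finset.mul_sum]

theorem IsSignedPerm.mem_symM {Q : O3} {σ : Fin 3 → Fin 3} {s : Fin 3 → ℤ}
    (h : IsSignedPerm Q σ s) {mat : Material} :
    Q ∈ symM mat ↔ ∀ i j k l m,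
      s i * s j * s k * s l * s m * mat.M (σ i) (σ j) (σ k) (σ l) (σ m) = mat.M i j k l m := by
  have e : ∀ (i : Fin 3) (F : Fin 3 → ℝ), ∑ o, Q.1 i o * F o = s i * F (σ i) := by
    intro i F
    simp [h i]
  simp only [symM, Set.mem_ofPred_eq, mul_assoc, e, ← Finset.mul_sum]

end Invariance

/-! ### Test materials -/

section TestMaterials

/-- The Voigt index of a pair of indices. -/
def voigtIndex : Fin 3 → Fin 3 → Fin 6 := ![![0, 5, 4], ![5, 1, 3], ![4, 3, 2]]

/-- The Voigt matrices of the six basic tetragonal elasticity tensors, belonging to the constants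
`C₁₁, C₁₂, C₁₃, C₃₃, C₄₄, C₆₆`. -/
def tetragonalVoigt : Fin 6 → Fin 6 → Fin 6 → ℤ :=
  ![fun p q => if p = q ∧ (p = 0 ∨ p = 1) then 1 else 0,
    fun p q => if p = 0 ∧ q = 1 ∨ p = 1 ∧ q = 0 then 1 else 0,
    fun p q => if p = 2 ∧ (q = 0 ∨ q = 1) ∨ (p = 0 ∨ p = 1) ∧ q = 2 then 1 else 0,
    fun p q => if p = 2 ∧ q = 2 then 1 else 0,
    fun p q => if p = q ∧ (p = 3 ∨ p = 4) then 1 else 0,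
    fun p q => if p = 5 ∧ q = 5 then 1 else 0]

theorem tetragonalVoigt_symm : ∀ t p q : Fin 6, tetragonalVoigt t p q = tetragonalVoigt t q p := by
  decide +kernel

theorem voigtIndex_symm : ∀ i j, voigtIndex i j = voigtIndex j i := by decide

/-- The material with a basic tetragonal fourth-order tensor and `M = 0`, `A = 0`. -/
noncomputable def elasticMaterial (t : Fin 6) : Material where
  C i j l m := tetragonalVoigt t (voigtIndex i j) (voigtIndex l m)
  M _ _ _ _ _ := 0
  A _ _ _ _ _ _ := 0
  C_minor i j l m := by rw [voigtIndex_symm i j]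
  C_major i j l m := by rw [tetragonalVoigt_symm]
  M_left _ _ _ _ _ := rfl
  M_right _ _ _ _ _ := rfl
  A_minor _ _ _ _ _ _ := rfl
  A_major _ _ _ _ _ _ := rfl

/-- The fifth-order tensor with components `ε i` at `(i, i, i, 3, τ i)` and `(i, i, 3, i, τ i)`,
`i ≠ 3`. -/
def couplingTensor (τ : Fin 3 → Fin 3) (ε : Fin 3 → ℤ) (i j k l m : Fin 3) : ℤ :=
  if i = j ∧ i ≠ 2 ∧ (k = i ∧ l = 2 ∨ k = 2 ∧ l = i) ∧ m = τ i then ε i else 0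

/-- The material with fifth-order tensor `couplingTensor τ ε` and `C = 0`, `A = 0`. -/
noncomputable def couplingMaterial (τ : Fin 3 → Fin 3) (ε : Fin 3 → ℤ) : Material where
  C _ _ _ _ := 0
  M i j k l m := couplingTensor τ ε i j k l m
  A _ _ _ _ _ _ := 0
  C_minor _ _ _ _ := rfl
  C_major _ _ _ _ := rfl
  M_left i j k l m := by
    congr 1
    by_cases h : i = j
    · rw [h]
    · rw [couplingTensor, couplingTensor, if_neg (fun h' => h h'.1),
        if_neg (fun h' => h h'.1.symm)]
  M_right i j k l m := by
    simp only [couplingTensor, or_comm, and_comm]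
  A_minor _ _ _ _ _ _ := rfl
  A_major _ _ _ _ _ _ := rfl

theorem symA_eq_univ {mat : Material} (h : ∀ i j k l m n, mat.A i j k l m n = 0) :
    symA mat = Set.univ := by
  ext Q
  simp [symA, h]

theorem symM_eq_univ {mat : Material} (h : ∀ i j k l m, mat.M i j k l m = 0) :
    symM mat = Set.univ := by
  ext Q
  simp [symM, h]

theorem symC_eq_univ {mat : Material} (h : ∀ i j k l, mat.C i j k l = 0) :
    symC mat = Set.univ := by
  ext Q
  simp [symC, h]

theorem SymClass.group_le (K : SymClass) : K.group ≤ groupD4Z2c := by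
  have hR : rotQuarter ∈ groupD4Z2c := Subgroup.subset_closure (by simp)
  have hP : rotHalf ∈ groupD4Z2c := Subgroup.subset_closure (by simp)
  have hI : inversion ∈ groupD4Z2c := Subgroup.subset_closure (by simp)
  cases K <;> simp only [SymClass.group] <;> rw [Subgroup.closure_le] <;>
    simp only [Set.insert_subset_iff, Set.singleton_subset_iff, SetLike.mem_coe, hR, hP,
      mul_mem, hI, and_self]

theorem inClass_elasticMaterial (K : SymClass) (t : Fin 6) : InClass K (elasticMaterial t) := by
  have hC : (groupD4Z2c : Set O3) ⊆ symC (elasticMaterial t) := by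
    refine closure_subset_symC ?_
    rintro Q (rfl | rfl | rfl)
    · rw [isSignedPerm_rotQuarter.mem_symC]
      intro i j k l
      simp only [elasticMaterial]
      norm_cast
      revert t i j k l
      decide +kernel
    · rw [isSignedPerm_rotHalf.mem_symC]
      intro i j k l
      simp only [elasticMaterial]
      norm_cast
      revert t i j k l
      decide +kernel
    · rw [isSignedPerm_inversion.mem_symC]
      intro i j k l
      simp only [elasticMaterial]
      norm_cast
      revert t i j k l
      decide +kernel
  refine ⟨fun Q hQ => ⟨⟨?_, ?_⟩, hC (K.group_le hQ)⟩, hC⟩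
  · rw [symA_eq_univ (fun _ _ _ _ _ _ => rfl)]; trivial
  · rw [symM_eq_univ (fun _ _ _ _ _ => rfl)]; trivial

theorem inClass_couplingMaterial {K : SymClass} {τ : Fin 3 → Fin 3} {ε : Fin 3 → ℤ}
    (h : (K.group : Set O3) ⊆ symM (couplingMaterial τ ε)) : InClass K (couplingMaterial τ ε) := by
  have hC : symC (couplingMaterial τ ε) = Set.univ := symC_eq_univ fun _ _ _ _ => rfl
  refine ⟨fun Q hQ => ⟨⟨?_, h hQ⟩, ?_⟩, ?_⟩
  · rw [symA_eq_univ (fun _ _ _ _ _ _ => rfl)]; trivial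
  · rw [hC]; trivial
  · rw [hC]; exact Set.subset_univ _

theorem IsSignedPerm.mem_symM_couplingMaterial {Q : O3} {σ : Fin 3 → Fin 3} {s : Fin 3 → ℤ}
    (h : IsSignedPerm Q σ s) {τ : Fin 3 → Fin 3} {ε : Fin 3 → ℤ}
    (hτ : ∀ i j k l m, s i * s j * s k * s l * s m *
      couplingTensor τ ε (σ i) (σ j) (σ k) (σ l) (σ m) = couplingTensor τ ε i j k l m) :
    Q ∈ symM (couplingMaterial τ ε) := by
  rw [h.mem_symM]
  intro i j k l m
  simp only [couplingMaterial]
  exact_mod_cast hτ i j k l m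

/-- Every class contains a material that detects the third derivatives of a plane harmonic
out-of-plane displacement. -/
theorem exists_inClass_couplingMaterial (K : SymClass) :
    ∃ (τ : Fin 3 → Fin 3) (ε : Fin 3 → ℤ), (τ = ![0, 1, 2] ∨ τ = ![1, 0, 2]) ∧
      ε 0 ≠ 0 ∧ ε 1 ≠ 0 ∧ InClass K (couplingMaterial τ ε) := by
  cases K
  -- With `τ` the identity, the components 11131 and 22232 are interchanged by the quarter turn
  -- without a sign; the inversion changes the sign of an odd-order tensor, so the rotoinversion
  -- requires `ε 1 = -ε 0`. The half turn in `𝔻₄` kills 11131, having a single index 3 and no index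
  -- 2, so that class uses 11132 and 22231, which the quarter turn interchanges with a minus sign.
  -- The value `ε 2` is never read.
  · refine ⟨![0, 1, 2], ![1, -1, 0], Or.inl rfl, by simp, by simp, inClass_couplingMaterial
      (closure_subset_symM ?_)⟩
    rintro Q rfl
    exact isSignedPerm_rotQuarter.inversion_mul.mem_symM_couplingMaterial (by decide +kernel)
  · refine ⟨![0, 1, 2], ![1, -1, 0], Or.inl rfl, by simp, by simp, inClass_couplingMaterial
      (closure_subset_symM ?_)⟩
    rintro Q (rfl | rfl)
    · exact isSignedPerm_rotQuarter.inversion_mul.mem_symM_couplingMaterial (by decide +kernel)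
    · exact isSignedPerm_rotHalf.inversion_mul.mem_symM_couplingMaterial (by decide +kernel)
  · refine ⟨![0, 1, 2], ![1, 1, 0], Or.inl rfl, by simp, by simp, inClass_couplingMaterial
      (closure_subset_symM ?_)⟩
    rintro Q (rfl | rfl)
    · exact isSignedPerm_rotQuarter.mem_symM_couplingMaterial (by decide +kernel)
    · exact isSignedPerm_rotHalf.inversion_mul.mem_symM_couplingMaterial (by decide +kernel)
  · refine ⟨![0, 1, 2], ![1, 1, 0], Or.inl rfl, by simp, by simp, inClass_couplingMaterial
      (closure_subset_symM ?_)⟩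
    rintro Q rfl
    exact isSignedPerm_rotQuarter.mem_symM_couplingMaterial (by decide +kernel)
  · refine ⟨![1, 0, 2], ![1, -1, 0], Or.inr rfl, by simp, by simp, inClass_couplingMaterial
      (closure_subset_symM ?_)⟩
    rintro Q (rfl | rfl)
    · exact isSignedPerm_rotQuarter.mem_symM_couplingMaterial (by decide +kernel)
    · exact isSignedPerm_rotHalf.mem_symM_couplingMaterial (by decide +kernel)

end TestMaterials


section Universal

variable {Ω : Set Space} {u : Space → Space} {x : Space} {K : SymClass}

/-! ### Consequences of universality -/

theorem sum_elasticMaterial_eq_zero (hΩ : IsOpen Ω) (hu : ContDiffOn ℝ 4 u Ω)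
    (h : IsUniversal (InClass K) Ω u) (hx : x ∈ Ω) (t : Fin 6) (k : Fin 3) :
    ∑ i, ∑ l, ∑ m, (tetragonalVoigt t (voigtIndex i k) (voigtIndex l m) : ℝ) *
      partialD i (strain u l m) x = 0 := by
  have := h _ (inClass_elasticMaterial K t) x hx k
  simp only [partialD_cauchyStress hΩ hu _ _ _ hx, partialD_partialD_hyperStress hΩ hu _ _ _ _ hx]
    at this
  simpa [elasticMaterial] using this

/-- The linear conditions on the second derivatives `w k i j = u_{k,ij}` that hold for universal
fields of the tetragonal class of classical elasticity. -/
structure TetragonalHessian (w : Fin 3 → Fin 3 → Fin 3 → ℝ) : Prop where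
  u0_00 : w 0 0 0 = 0
  u0_01 : w 0 0 1 = 0
  u0_11 : w 0 1 1 = 0
  u0_22 : w 0 2 2 = 0
  u1_00 : w 1 0 0 = 0
  u1_01 : w 1 0 1 = 0
  u1_11 : w 1 1 1 = 0
  u1_22 : w 1 2 2 = 0
  u2_02 : w 2 0 2 = 0
  u2_12 : w 2 1 2 = 0
  u2_22 : w 2 2 2 = 0
  u01 : w 0 0 2 + w 1 1 2 = 0
  u2 : w 2 0 0 + w 2 1 1 = 0

/-- The six constants enter equilibrium linearly and independently. `C₁₁, C₁₂, C₃₃` give single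
second derivatives; `C₁₃` gives `u_{3,13} = u_{3,23} = 0` and `u01`. Substituting these into the
equations of `C₄₄` and `C₆₆` isolates the other derivatives and the Laplace equation `u2`. -/
theorem tetragonalHessian_of_isUniversal (hΩ : IsOpen Ω) (hu : ContDiffOn ℝ 4 u Ω)
    (h : IsUniversal (InClass K) Ω u) (hx : x ∈ Ω) :
    TetragonalHessian fun k i j => partialD i (partialD j fun y => u y k) x := by
  have hc : ∀ i j k, partialD i (partialD j fun y => u y k) x =
      partialD j (partialD i fun y => u y k) x := fun i j k =>
    partialD_comm hΩ ((contDiffOn_component hu k).of_le (by norm_num)) i j hx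
  have e := sum_elasticMaterial_eq_zero hΩ hu h hx
  have s := fun i l m => partialD_strain hΩ hu i l m hx
  have e1 := fun k => e 0 k
  have e2 := fun k => e 1 k
  have e3 := fun k => e 2 k
  have e4 := e 3 2
  have e5 := fun k => e 4 k
  have e6 := fun k => e 5 k
  simp only [s, Fin.sum_univ_three, tetragonalVoigt, voigtIndex] at e1 e2 e3 e4 e5 e6
  have e10 := e1 0
  have e11 := e1 1
  have e20 := e2 0
  have e21 := e2 1
  have e30 := e3 0
  have e31 := e3 1
  have e32 := e3 2
  have e50 := e5 0
  have e51 := e5 1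
  have e52 := e5 2
  have e60 := e6 0
  have e61 := e6 1
  clear e e1 e2 e3 e5 e6 s
  simp at e10 e11 e20 e21 e30 e31 e32 e4 e50 e51 e52 e60 e61
  have hc01 := fun k => hc 1 0 k
  have hc02 := fun k => hc 2 0 k
  have hc12 := fun k => hc 2 1 k
  simp only [hc01, hc02, hc12] at e20 e21 e30 e31 e32 e50 e51 e52 e60 e61
  constructor <;> linarith

/-- Third derivatives `T n i j`, symmetric in all indices, vanish if their sorted components do. -/
theorem thirdDerivatives_eq_zero {T : Fin 3 → Fin 3 → Fin 3 → ℝ} (h1 : ∀ n i j, T n i j = T i n j)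
    (h2 : ∀ n i j, T n i j = T n j i) (h00 : ∀ n, T n 0 0 = 0) (h01 : ∀ n, T n 0 1 = 0)
    (h11 : ∀ n, T n 1 1 = 0) (h22 : ∀ n, T n 2 2 = 0) (n i j : Fin 3) : T n i j = 0 := by
  -- Pigeonhole: among three indices either two lie in {1, 2} or two equal 3, and symmetry moves
  -- that pair to the last two slots.
  have h10 : ∀ n, T n 1 0 = 0 := fun n => (h2 n 1 0).trans (h01 n)
  have h02 : ∀ n, T n 0 2 = 0 := by
    intro n
    rw [h1]
    fin_cases n
    · exact (h1 0 0 2).trans ((h2 0 0 2).trans ((h1 0 2 0).trans (h00 2)))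
    · exact (h2 0 1 2).trans ((h1 0 2 1).trans (h01 2))
    · exact h22 0
  have h12 : ∀ n, T n 1 2 = 0 := by
    intro n
    rw [h1]
    fin_cases n
    · exact (h2 1 0 2).trans ((h1 1 2 0).trans (h10 2))
    · exact (h2 1 1 2).trans ((h1 1 2 1).trans (h11 2))
    · exact h22 1
  fin_cases i <;> fin_cases j
  · exact h00 n
  · exact h01 n
  · exact h02 n
  · exact h10 n
  · exact h11 n
  · exact h12 n
  · exact (h2 n 2 0).trans (h02 n)
  · exact (h2 n 2 1).trans (h12 n)
  · exact h22 n

theorem partialD_eq_zero_of_eqOn {f : Space → ℝ} (hΩ : IsOpen Ω) (h : ∀ y ∈ Ω, f y = 0)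
    (i : Fin 3) (hx : x ∈ Ω) : partialD i f x = 0 := by
  rw [partialD_congr hΩ (g := fun _ => 0) h i hx, partialD_const]

theorem contDiffOn_partialD_partialD (hΩ : IsOpen Ω) (hu : ContDiffOn ℝ 4 u Ω) (i j k : Fin 3) :
    ContDiffOn ℝ 2 (partialD i (partialD j fun y => u y k)) Ω :=
  contDiffOn_partialD (n := 3) hΩ
    (contDiffOn_partialD hΩ (contDiffOn_component hu k) (by norm_num) j) (by norm_num) i

theorem partialD_third_swap_left (hΩ : IsOpen Ω) (hu : ContDiffOn ℝ 4 u Ω) (hx : x ∈ Ω)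
    (k n i j : Fin 3) : partialD n (partialD i (partialD j fun y => u y k)) x =
      partialD i (partialD n (partialD j fun y => u y k)) x :=
  partialD_comm hΩ (contDiffOn_partialD hΩ (contDiffOn_component hu k) (by norm_num) j) n i hx

theorem partialD_third_swap_right (hΩ : IsOpen Ω) (hu : ContDiffOn ℝ 4 u Ω) (hx : x ∈ Ω)
    (k n i j : Fin 3) : partialD n (partialD i (partialD j fun y => u y k)) x =
      partialD n (partialD j (partialD i fun y => u y k)) x :=
  partialD_congr hΩ (fun _ hy =>
    partialD_comm hΩ ((contDiffOn_component hu k).of_le (by norm_num)) i j hy) n hx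

theorem thirdDerivatives_inPlane_eq_zero (hΩ : IsOpen Ω) (hu : ContDiffOn ℝ 4 u Ω)
    (h : IsUniversal (InClass K) Ω u) (hx : x ∈ Ω) (n i j : Fin 3) :
    partialD n (partialD i (partialD j fun y => u y 0)) x = 0 ∧
      partialD n (partialD i (partialD j fun y => u y 1)) x = 0 := by
  have hw := fun y (hy : y ∈ Ω) => tetragonalHessian_of_isUniversal hΩ hu h hy
  exact ⟨thirdDerivatives_eq_zero
      (T := fun n i j => partialD n (partialD i (partialD j fun y => u y 0)) x)
      (partialD_third_swap_left hΩ hu hx 0) (partialD_third_swap_right hΩ hu hx 0)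
      (fun n => partialD_eq_zero_of_eqOn hΩ (fun y hy => (hw y hy).u0_00) n hx)
      (fun n => partialD_eq_zero_of_eqOn hΩ (fun y hy => (hw y hy).u0_01) n hx)
      (fun n => partialD_eq_zero_of_eqOn hΩ (fun y hy => (hw y hy).u0_11) n hx)
      (fun n => partialD_eq_zero_of_eqOn hΩ (fun y hy => (hw y hy).u0_22) n hx) n i j,
    thirdDerivatives_eq_zero
      (T := fun n i j => partialD n (partialD i (partialD j fun y => u y 1)) x)
      (partialD_third_swap_left hΩ hu hx 1) (partialD_third_swap_right hΩ hu hx 1)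
      (fun n => partialD_eq_zero_of_eqOn hΩ (fun y hy => (hw y hy).u1_00) n hx)
      (fun n => partialD_eq_zero_of_eqOn hΩ (fun y hy => (hw y hy).u1_01) n hx)
      (fun n => partialD_eq_zero_of_eqOn hΩ (fun y hy => (hw y hy).u1_11) n hx)
      (fun n => partialD_eq_zero_of_eqOn hΩ (fun y hy => (hw y hy).u1_22) n hx) n i j⟩

/-- For `k ≠ 2` the first sum is `ε k` times `u_{3,kk τ(k)}` plus a third derivative of `u_k`. The
second sum contains only the strains `e_11` and `e_22`, so it vanishes with the third derivatives of
the in-plane components. -/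
theorem sum_couplingMaterial_eq_zero (hΩ : IsOpen Ω) (hu : ContDiffOn ℝ 4 u Ω)
    (h : IsUniversal (InClass K) Ω u) (hx : x ∈ Ω) {τ : Fin 3 → Fin 3} {ε : Fin 3 → ℤ}
    (hK : InClass K (couplingMaterial τ ε)) (k : Fin 3) :
    ∑ i, ∑ l, ∑ m, ∑ n, (couplingTensor τ ε i k l m n : ℝ) *
        partialD i (partialD n (strain u l m)) x -
      ∑ i, ∑ j, ∑ l, ∑ m, (couplingTensor τ ε l m i j k : ℝ) *
        partialD i (partialD j (strain u l m)) x = 0 := by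
  have := h _ hK x hx k
  simp only [partialD_cauchyStress hΩ hu _ _ _ hx, partialD_partialD_hyperStress hΩ hu _ _ _ _ hx]
    at this
  simpa [couplingMaterial] using this

theorem thirdDerivatives_outOfPlane_eq_zero (hΩ : IsOpen Ω) (hu : ContDiffOn ℝ 4 u Ω)
    (h : IsUniversal (InClass K) Ω u) (hx : x ∈ Ω) (n i j : Fin 3) :
    partialD n (partialD i (partialD j fun y => u y 2)) x = 0 := by
  have hw := fun y (hy : y ∈ Ω) => tetragonalHessian_of_isUniversal hΩ hu h hy
  have hp := thirdDerivatives_inPlane_eq_zero hΩ hu h hx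
  have hp0 := fun n i j => (hp n i j).1
  have hp1 := fun n i j => (hp n i j).2
  have h02 : ∀ n, partialD n (partialD 0 (partialD 2 fun y => u y 2)) x = 0 := fun n =>
    partialD_eq_zero_of_eqOn hΩ (fun y hy => (hw y hy).u2_02) n hx
  have h12 : ∀ n, partialD n (partialD 1 (partialD 2 fun y => u y 2)) x = 0 := fun n =>
    partialD_eq_zero_of_eqOn hΩ (fun y hy => (hw y hy).u2_12) n hx
  have hΔ : ∀ n, partialD n (partialD 0 (partialD 0 fun y => u y 2)) x +
      partialD n (partialD 1 (partialD 1 fun y => u y 2)) x = 0 := by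
    intro n
    rw [← partialD_add n
      (differentiableAt_of_contDiffOn hΩ (contDiffOn_partialD_partialD hΩ hu 0 0 2) (by norm_num) hx)
      (differentiableAt_of_contDiffOn hΩ (contDiffOn_partialD_partialD hΩ hu 1 1 2) (by norm_num) hx)]
    exact partialD_eq_zero_of_eqOn hΩ (fun y hy => (hw y hy).u2) n hx
  have s1 := partialD_third_swap_left hΩ hu hx 2
  have s2 := partialD_third_swap_right hΩ hu hx 2
  have hs : partialD 0 (partialD 0 (partialD 0 fun y => u y 2)) x = 0 ∧
      partialD 1 (partialD 1 (partialD 1 fun y => u y 2)) x = 0 := by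
    obtain ⟨τ, ε, hτ, h0, h1, hK⟩ := exists_inClass_couplingMaterial K
    have e := sum_couplingMaterial_eq_zero hΩ hu h hx hK
    have e0 := e 0
    have e1 := e 1
    rcases hτ with rfl | rfl
    · simp [couplingTensor, Fin.sum_univ_three, partialD_partialD_strain hΩ hu _ _ _ _ hx, hp0, hp1,
        h0, h1] at e0 e1
      exact ⟨e0, e1⟩
    · simp [couplingTensor, Fin.sum_univ_three, partialD_partialD_strain hΩ hu _ _ _ _ hx, hp0, hp1,
        h0, h1] at e0 e1
      -- Here the equations give the mixed derivatives `u_{3,112}` and `u_{3,122}`; harmonicity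
      -- turns them into the pure ones.
      have e0' := (s1 1 0 0).trans e0
      have e1' := (s1 0 1 1).trans e1
      exact ⟨by linarith [hΔ 0], by linarith [hΔ 1]⟩
  have d0 := hΔ 0
  have d1 := hΔ 1
  have h001 : partialD 0 (partialD 0 (partialD 1 fun y => u y 2)) x = 0 := by
    rw [s2, s1]; linarith [hs.2]
  have h101 : partialD 1 (partialD 0 (partialD 1 fun y => u y 2)) x = 0 := by
    rw [s1]; linarith [hs.1]
  refine thirdDerivatives_eq_zero
    (T := fun n i j => partialD n (partialD i (partialD j fun y => u y 2)) x) s1 s2 ?_ ?_ ?_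
    (fun n => partialD_eq_zero_of_eqOn hΩ (fun y hy => (hw y hy).u2_22) n hx) n i j
  · intro n
    fin_cases n
    · exact hs.1
    · exact (s1 1 0 0).trans ((s2 0 1 0).trans h001)
    · exact (s1 2 0 0).trans ((s2 0 2 0).trans (h02 0))
  · intro n
    fin_cases n
    · exact h001
    · exact h101
    · exact (s1 2 0 1).trans ((s2 0 2 1).trans (h12 0))
  · intro n
    fin_cases n
    · exact (s1 0 1 1).trans h101
    · exact hs.2
    · exact (s1 2 1 1).trans ((s2 1 2 1).trans (h12 1))

end Universal

/-! ### Quadratic fields: the explicit form and its sufficiency -/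

section Characterization

variable {Ω : Set Space} {u : Space → Space} {K : SymClass}

theorem isRestrictedTetragonal_of_isUniversal (hΩ : IsOpen Ω) (hconn : IsConnected Ω)
    (hu : ContDiffOn ℝ 4 u Ω) (h : IsUniversal (InClass K) Ω u) : IsRestrictedTetragonal Ω u := by
  have hD : ∀ x ∈ Ω, ∀ k n i j, partialD n (partialD i (partialD j fun y => u y k)) x = 0 := by
    intro x hx k n i j
    fin_cases k
    · exact (thirdDerivatives_inPlane_eq_zero hΩ hu h hx n i j).1
    · exact (thirdDerivatives_inPlane_eq_zero hΩ hu h hx n i j).2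
    · exact thirdDerivatives_outOfPlane_eq_zero hΩ hu h hx n i j
  have hconst : ∀ k i j, ∃ c, ∀ x ∈ Ω, partialD i (partialD j fun y => u y k) x = c := fun k i j =>
    exists_const_of_partialD_eq_zero hΩ hconn.isPreconnected
      ((contDiffOn_partialD_partialD hΩ hu i j k).of_le (by norm_num)) fun x hx n => hD x hx k n i j
  choose w hw using hconst
  obtain ⟨x₀, hx₀⟩ := hconn.nonempty
  have hsymm : ∀ k i j, w k i j = w k j i := fun k i j => by
    rw [← hw k i j x₀ hx₀, ← hw k j i x₀ hx₀]
    exact partialD_comm hΩ ((contDiffOn_component hu k).of_le (by norm_num)) i j hx₀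
  have hT : TetragonalHessian w := by
    have := tetragonalHessian_of_isUniversal hΩ hu h hx₀
    simpa only [hw _ _ _ x₀ hx₀] using this
  have hpoly : ∀ k, ∃ a b, ∀ x ∈ Ω, u x k = quadraticFn a b (w k) x := fun k =>
    exists_eq_quadraticFn hΩ hconn.isPreconnected
      ((contDiffOn_component hu k).of_le (by norm_num)) (hsymm k) fun x hx i j => hw k i j x hx
  choose a b hab using hpoly
  -- The affine part of `g` is absorbed into `a` and `H`. In `d₅(x₂² - x₁²)` the second derivative
  -- in `x₂` is `2 d₅`, hence the half.
  refine ⟨a, Matrix.of b, w 0 1 2, w 0 0 2, w 1 0 2, ![0, 0, 0, w 2 0 1, w 2 1 1 / 2],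
    fun x hx => ?_⟩
  have q : ∀ k, quadraticFn (a k) (b k) (w k) x = a k + (b k 0 * x 0 + b k 1 * x 1 + b k 2 * x 2) +
      (w k 0 0 / 2 * x 0 ^ 2 + w k 1 1 / 2 * x 1 ^ 2 + w k 2 2 / 2 * x 2 ^ 2 +
        w k 0 1 * (x 0 * x 1) + w k 0 2 * (x 0 * x 2) + w k 1 2 * (x 1 * x 2)) := fun k => by
    simp only [quadraticFn, Fin.sum_univ_three, hsymm k 1 0, hsymm k 2 0, hsymm k 2 1]
    ring
  have hH : ∀ k, (Matrix.of b).mulVec x k = b k 0 * x 0 + b k 1 * x 1 + b k 2 * x 2 := fun k => by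
    simp [Matrix.mulVec, dotProduct, Fin.sum_univ_three]
  ext k
  rw [hab k x hx, q k, Pi.add_apply, homogeneousField, Pi.add_apply, hH]
  fin_cases k
  · simp [tetragonalField, hT.u0_00, hT.u0_01, hT.u0_11, hT.u0_22]
    ring
  · simp [tetragonalField, hT.u1_00, hT.u1_01, hT.u1_11, hT.u1_22]
    linear_combination x 1 * x 2 * hT.u01
  · simp [tetragonalField, harmonicQuadratic, hT.u2_02, hT.u2_12, hT.u2_22]
    linear_combination x 0 ^ 2 / 2 * hT.u2

/-- The Hessians of the components of a tetragonal field. -/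
def tetragonalHessian (c₁ c₂ c₃ d₄ d₅ : ℝ) : Fin 3 → Fin 3 → Fin 3 → ℝ :=
  ![![![0, 0, c₂], ![0, 0, c₁], ![c₂, c₁, 0]],
    ![![0, 0, c₃], ![0, 0, -c₂], ![c₃, -c₂, 0]],
    ![![-(2 * d₅), d₄, 0], ![d₄, 2 * d₅, 0], ![0, 0, 0]]]

theorem tetragonalHessian_symm (c₁ c₂ c₃ d₄ d₅ : ℝ) (k i j : Fin 3) :
    tetragonalHessian c₁ c₂ c₃ d₄ d₅ k i j = tetragonalHessian c₁ c₂ c₃ d₄ d₅ k j i := by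
  fin_cases k <;> fin_cases i <;> fin_cases j <;> rfl

theorem exists_partialD_partialD_eq_tetragonalHessian (hΩ : IsOpen Ω)
    (h : IsRestrictedTetragonal Ω u) : ∃ c₁ c₂ c₃ d₄ d₅ : ℝ, ∀ x ∈ Ω, ∀ i j k,
      partialD i (partialD j fun y => u y k) x = tetragonalHessian c₁ c₂ c₃ d₄ d₅ k i j := by
  obtain ⟨a, H, c₁, c₂, c₃, d, h⟩ := h
  refine ⟨c₁, c₂, c₃, d 3, d 4, fun x hx i j k => ?_⟩
  have hs := tetragonalHessian_symm c₁ c₂ c₃ (d 3) (d 4)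
  have hq : Set.EqOn (fun y => u y k) (quadraticFn (a k + ![0, 0, d 0] k)
      (H k + ![0, 0, ![d 1, d 2, 0]] k) (tetragonalHessian c₁ c₂ c₃ (d 3) (d 4) k)) Ω := by
    intro y hy
    simp only [h y hy, homogeneousField, Pi.add_apply, Matrix.mulVec, dotProduct, quadraticFn,
      Fin.sum_univ_three]
    fin_cases k <;> simp [tetragonalField, tetragonalHessian, harmonicQuadratic] <;> ring
  rw [partialD_congr hΩ (fun y hy => partialD_congr hΩ hq j hy) i hx,
    partialD_partialD_quadraticFn _ _ (hs k), hs]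

/-- Every class contains the four-fold rotation about the `x₃`-axis or its product with the
inversion. -/
theorem SymClass.exists_mem_group (K : SymClass) : ∃ Q ∈ K.group, ∃ s : Fin 3 → ℤ,
    IsSignedPerm Q ![1, 0, 2] s ∧ (s = ![-1, 1, 1] ∨ s = ![1, -1, -1]) := by
  have e : (fun i => -(![-1, 1, 1] : Fin 3 → ℤ) i) = ![1, -1, -1] := by decide
  have h1 := isSignedPerm_rotQuarter
  have h2 := h1.inversion_mul
  rw [e] at h2
  cases K
  · exact ⟨_, Subgroup.subset_closure (by simp), _, h2, Or.inr rfl⟩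
  · exact ⟨_, Subgroup.subset_closure (by simp), _, h2, Or.inr rfl⟩
  · exact ⟨_, Subgroup.subset_closure (by simp), _, h1, Or.inl rfl⟩
  · exact ⟨_, Subgroup.subset_closure (by simp), _, h1, Or.inl rfl⟩
  · exact ⟨_, Subgroup.subset_closure (by simp), _, h1, Or.inl rfl⟩

/-- What survives in the third component is `C₁₃ (u_{1,13} + u_{2,23})` plus `C₄₄ (u_{1,13} +
u_{2,23} + u_{3,11} + u_{3,22})`, and both brackets vanish for this family. -/
theorem isUniversal_of_isRestrictedTetragonal (hΩ : IsOpen Ω) (hu : ContDiffOn ℝ 4 u Ω)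
    (h : IsRestrictedTetragonal Ω u) : IsUniversal (HasSymmetry K) Ω u := by
  obtain ⟨c₁, c₂, c₃, d₄, d₅, hH⟩ := exists_partialD_partialD_eq_tetragonalHessian hΩ h
  intro mat hmat x hx k
  have h1 : ∀ y ∈ Ω, ∀ i l m, partialD i (strain u l m) y =
      (tetragonalHessian c₁ c₂ c₃ d₄ d₅ l i m + tetragonalHessian c₁ c₂ c₃ d₄ d₅ m i l) / 2 :=
    fun y hy i l m => by rw [partialD_strain hΩ hu i l m hy, hH y hy, hH y hy]
  have h2 : ∀ y ∈ Ω, ∀ i j l m, partialD i (partialD j (strain u l m)) y = 0 :=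
    fun y hy i j l m => by
      rw [partialD_congr hΩ (g := fun _ => _) (fun z hz => h1 z hz j l m) i hy, partialD_const]
  have h3 : ∀ i j n l m, partialD i (partialD j (partialD n (strain u l m))) x = 0 :=
    fun i j n l m => partialD_eq_zero_of_eqOn hΩ (fun y hy => h2 y hy j n l m) i hx
  simp only [partialD_cauchyStress hΩ hu _ _ _ hx, partialD_partialD_hyperStress hΩ hu _ _ _ _ hx,
    h1 x hx, h2 x hx, h3, mul_zero, Finset.sum_const_zero, add_zero, sub_zero]
  obtain ⟨Q, hQ, s, hQs, hs⟩ := K.exists_mem_group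
  have hC := hQs.mem_symC.1 (hmat hQ).2
  -- The product of four signs does not see the inversion, so rotation and rotoinversion constrain
  -- `C` alike.
  have hC' : ∀ i j k l, ((![-1, 1, 1] i * ![-1, 1, 1] j * ![-1, 1, 1] k * ![-1, 1, 1] l : ℤ) : ℝ) *
      mat.C (![1, 0, 2] i) (![1, 0, 2] j) (![1, 0, 2] k) (![1, 0, 2] l) = mat.C i j k l := by
    intro i j k l
    rw [← hC i j k l]
    congr 1
    norm_cast
    rcases hs with rfl | rfl
    · rfl
    · revert i j k l; decide
  clear hmat hC hH h1 h2 h3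
  have hm : ∀ i j l m, mat.C i j l m = mat.C i j m l := fun i j l m => by
    rw [mat.C_major, mat.C_minor, mat.C_major]
  -- The square of the quarter turn is diag(-1, -1, 1); applying `hC'` twice kills every component
  -- with an odd number of indices 3.
  have hodd : ∀ i j k l,
      (![-1, -1, 1] i * ![-1, -1, 1] j * ![-1, -1, 1] k * ![-1, -1, 1] l : ℤ) = -1 →
        mat.C i j k l = 0 := by
    intro i j k l ho
    have h := hC' i j k l
    rw [← hC' (![1, 0, 2] i), ← mul_assoc] at h
    have hσ : ∀ i : Fin 3, (![1, 0, 2] : Fin 3 → Fin 3) (![1, 0, 2] i) = i := by decide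
    have ht : ∀ i : Fin 3, (![-1, -1, 1] : Fin 3 → ℤ) i =
      ![-1, 1, 1] i * ![-1, 1, 1] (![1, 0, 2] i) := by decide
    rw [hσ, hσ, hσ, hσ, ← Int.cast_mul] at h
    rw [ht i, ht j, ht k, ht l] at ho
    rw [show ∀ a b c d a' b' c' d' : ℤ, a * b * c * d * (a' * b' * c' * d') =
      a * a' * (b * b') * (c * c') * (d * d') from fun _ _ _ _ _ _ _ _ => by ring, ho] at h
    push_cast at h
    linarith
  -- Every nonzero `e_{lm,i}` of the family has exactly one index 3. For `k = 0, 1` it thus meets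
  -- only components killed by `hodd`, and only `k = 2` remains.
  fin_cases k <;> simp [Fin.sum_univ_three, tetragonalHessian, hodd]
  have e1 := hC' 1 2 1 2
  have e2 := hC' 0 2 1 2
  have e3 := hC' 2 2 0 1
  have e4 := hC' 2 2 0 0
  simp at e1 e2 e3 e4
  have z1 : mat.C 0 2 1 2 = 0 := by linarith [mat.C_major 1 2 0 2]
  have z2 : mat.C 2 2 0 1 = 0 := by linarith [hm 2 2 1 0]
  rw [hm 0 2 2 0, hm 0 2 2 1, hm 1 2 2 0, hm 1 2 2 1, hm 2 2 1 0, ← e1,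
    mat.C_major 1 2 0 2, z1, z2, e4]
  ring

end Characterization
end StrainGradient

theorem mainTheorem7 (K : StrainGradient.SymClass) (Ω : Set StrainGradient.Space)
    (hΩ : IsOpen Ω) (hconn : IsConnected Ω)
    (u : StrainGradient.Space → StrainGradient.Space) (hu : ContDiffOn ℝ 4 u Ω) :
    (StrainGradient.IsUniversal (StrainGradient.InClass K) Ω u ↔
      StrainGradient.IsRestrictedTetragonal Ω u) ∧
    (StrainGradient.IsUniversal (StrainGradient.HasSymmetry K) Ω u ↔
      StrainGradient.IsRestrictedTetragonal Ω u) := by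
  have h1 : StrainGradient.IsUniversal (StrainGradient.HasSymmetry K) Ω u →
      StrainGradient.IsUniversal (StrainGradient.InClass K) Ω u :=
    fun h mat hmat => h mat hmat.1
  have h2 : StrainGradient.IsUniversal (StrainGradient.InClass K) Ω u →
      StrainGradient.IsRestrictedTetragonal Ω u :=
    StrainGradient.isRestrictedTetragonal_of_isUniversal hΩ hconn hu
  have h3 : StrainGradient.IsRestrictedTetragonal Ω u →
      StrainGradient.IsUniversal (StrainGradient.HasSymmetry K) Ω u :=
    StrainGradient.isUniversal_of_isRestrictedTetragonal hΩ hu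
  exact ⟨⟨h2, fun h => h1 (h3 h)⟩, ⟨fun h => h2 (h1 h), h3⟩⟩
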